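/- All groups are finite. Let $N$ be a normal subgroup of a group $G$. The pair $(G,N)$ is a Camina pair if $1 \ne N \ne G$ and every $x \in G \setminus N$ is conjugate in $G$ to every element of the coset $xN$; a Camina pair $(G,N)$ is of Type (4) if, for some prime $q$, $G/N$ is a $q$-group and $q$ divides $|N|$, but $N$ is not a $q$-group. For a prime $p$, let $O_p(G)$ be the largest normal $p$-subgroup of $G$, and $O_{p'}(G)$ the largest normal subgroup of $G$ of order prime to $p$. Lemma 3.3. Let $(G,N)$ be a Camina pair of Type (4). Let $p$ be the prime such that $G/N$ is a $p$-group, and let $P$ be a Sylow $p$-subgroup of $G$. Then $$O_p(G) = C_P(O_{p'}(G)) = \bigcap_{v \in O_{p'}(G)} C_P(v) < P \cap N,$$ where $<$ denotes proper containment. -/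

import Mathlib

/-- `(G, N)` is a Camina pair: `N` is a proper nontrivial normal subgroup of `G` and every
`x ∈ G \ N` is conjugate in `G` to every element of the coset `xN`. -/
structure IsCaminaPair {G : Type*} [Group G] (N : Subgroup G) [N.Normal] : Prop where
  ne_bot : N ≠ ⊥
  ne_top : N ≠ ⊤
  isConj : ∀ x : G, x ∉ N → ∀ n ∈ N, IsConj x (x * n)

/-- A Camina pair `(G, N)` is of Type (4) if, for some prime `p`, the quotient `G/N` is a
`p`-group and `p` divides `|N|`, but `N` is not a `p`-group. -/
def IsCaminaPairType4 {G : Type*} [Group G] (N : Subgroup G) [N.Normal] : Prop :=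
  IsCaminaPair N ∧
    ∃ p : ℕ, p.Prime ∧ IsPGroup p (G ⧸ N) ∧ p ∣ Nat.card N ∧ ¬ IsPGroup p N

/-- `O_p(G)`: the subgroup generated by all normal `p`-subgroups of `G` (for finite `G`, the
largest normal `p`-subgroup). -/
def pCore (p : ℕ) (G : Type*) [Group G] : Subgroup G :=
  sSup {H : Subgroup G | H.Normal ∧ IsPGroup p H}

/-- `O_{p'}(G)`: the subgroup generated by all normal `p'`-subgroups of the finite group `G`,
those of order prime to `p` (it is the largest such subgroup). -/
def pPrimeCore (p : ℕ) (G : Type*) [Group G] : Subgroup G :=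
  sSup {H : Subgroup G | H.Normal ∧ Nat.Coprime p (Nat.card H)}

/-!
Let `(G, N)` be a Camina pair with `G/N` a `p`-group, and let `P` be a Sylow `p`-subgroup.

A counting argument (`exists_mem_conj_eq_mul`) shows that for `x ∈ P \ N` all elements of
`x(P ∩ N)` are conjugate to `x` already in `P`; hence `P ∩ N ≤ P'`. By Tate's theorem, proved here
with the transfer (`exists_extend_pow_index`, `exists_normal_complement_of_le_commutator`), `G` has
a normal `p`-complement `M`, which is then `O_{p'}(G)`. It is nontrivial because `N` is not a
`p`-group. Since `G = PM`, the subgroup `C_P(M)` is normal in `G`, and every normal `p`-subgroup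
lies in `P` and centralizes `M`; so `O_p(G) = C_P(M)`.

Every element outside `N` is a `p`-element, so nontrivial elements of `M` have their centralizers
in `N` (`IsCaminaPair.mem_of_commute`); thus `C_P(M) ≤ P ∩ N`. If equality held, `C = P ∩ N` would
centralize `M`, and `P/C` would act fixed-point-freely on `M` and on a nontrivial `P`-invariant
abelian subgroup of `M`. Commutative groups acting in this way are cyclic, so a maximal commutative
subgroup of `P/C` is generated by some `xC`, which is its own centralizer. The elements of `P` that
conjugate `x` into `xC` then lie in `⟨x⟩C`, so `C = [x, C]`, and `C = 1` as `P` is nilpotent. This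
contradicts `p ∣ |N|`.
-/

/-! ### Commutators in nilpotent groups and conjugacy in supplements -/

/-- In a nilpotent group a subgroup `Q` with `Q = [Q, G]` lies in every term of the lower central
series. -/
theorem Subgroup.eq_bot_of_le_commutator_top {G : Type*} [Group G] [Group.IsNilpotent G]
    (Q : Subgroup G) (h : Q ≤ ⁅Q, (⊤ : Subgroup G)⁆) : Q = ⊥ := by
  have key : ∀ n, Q ≤ (⊤ : Subgroup G).lowerCentralSeries n := by
    intro n
    induction n with
    | zero => simp
    | succ n ih =>
      rw [Subgroup.lowerCentralSeries_succ]
      exact h.trans (Subgroup.commutator_mono ih le_rfl)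
  obtain ⟨n, hn⟩ := Subgroup.nilpotent_iff_lowerCentralSeries.1 (inferInstance : Group.IsNilpotent G)
  exact le_bot_iff.1 (hn ▸ key n)

/-- Orbit-stabilizer for conjugation by a subgroup `T`, where `x` need not lie in `T`. -/
theorem Subgroup.ncard_conj_image_mul_card {G : Type*} [Group G] [Finite G] (T : Subgroup G)
    (x : G) :
    ((fun t ↦ t * x * t⁻¹) '' (T : Set G)).ncard *
      Nat.card (T ⊓ Subgroup.centralizer {x} : Subgroup G) = Nat.card T := by
  let act : MulAction T G := MulAction.compHom G (MulAut.conj.comp T.subtype)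
  have hsm : ∀ (t : T) (g : G), t • g = t * g * (t : G)⁻¹ := fun t g ↦ rfl
  have h1 : Nat.card (MulAction.orbit T x) * Nat.card (MulAction.stabilizer T x) = Nat.card T := by
    rw [← Nat.card_prod]
    exact Nat.card_congr (MulAction.orbitProdStabilizerEquivGroup T x)
  have h2 : MulAction.orbit T x = (fun t ↦ t * x * t⁻¹) '' (T : Set G) := by
    ext y
    simp [MulAction.mem_orbit_iff, hsm]
  have h3 : MulAction.stabilizer T x = (Subgroup.centralizer {x}).subgroupOf T := by
    ext t
    rw [MulAction.mem_stabilizer_iff, Subgroup.mem_subgroupOf, Subgroup.mem_centralizer_singleton_iff,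
      hsm, mul_inv_eq_iff_eq_mul]
  rw [← Nat.card_congr (Subgroup.subgroupOfEquivOfLe (inf_le_left :
    T ⊓ Subgroup.centralizer {x} ≤ T)).toEquiv, Subgroup.inf_subgroupOf_left, ← h3, ← h2]
  exact h1

/-- If all elements of `xN` are conjugate in `G` and `x` lies in a supplement `P` of `N`, then all
elements of `x(P ∩ N)` are already conjugate in `P`. Let `T` be the preimage of `C_{G/N}(xN)`. Then
`T` is transitive on `xN`, so `|T| = |N| |C_G(x)|` and `|T ∩ P| = |N ∩ P| |C_G(x)|`. Hence the
orbit of `x` under `T ∩ P`, which lies in `x(P ∩ N)`, has at least `|P ∩ N|` elements. -/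
theorem exists_mem_conj_eq_mul {G : Type*} [Group G] [Finite G] {N P : Subgroup G} [N.Normal]
    (hNP : N ⊔ P = ⊤) {x : G} (hxP : x ∈ P) (hx : ∀ n ∈ N, IsConj x (x * n)) {n : G}
    (hnP : n ∈ P) (hnN : n ∈ N) : ∃ s ∈ P, s * x * s⁻¹ = x * n := by
  let T : Subgroup G := (Subgroup.centralizer {(x : G ⧸ N)}).comap (QuotientGroup.mk' N)
  have hT : ∀ t, t ∈ T ↔ x⁻¹ * (t * x * t⁻¹) ∈ N := by
    intro t
    rw [← QuotientGroup.eq]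
    simp only [T, Subgroup.mem_comap, Subgroup.mem_centralizer_singleton_iff,
      QuotientGroup.mk'_apply, QuotientGroup.mk_mul, QuotientGroup.mk_inv]
    rw [eq_mul_inv_iff_mul_eq, eq_comm]
  have hNT : N ≤ T := by
    intro m hm
    rw [hT, mul_assoc, ← mul_assoc]
    have := ‹N.Normal›.conj_mem m hm x⁻¹
    rw [inv_inv] at this
    simpa [mul_assoc] using N.mul_mem this (N.inv_mem hm)
  have hCT : Subgroup.centralizer {x} ≤ T := by
    intro c hc
    rw [hT]
    rw [Subgroup.mem_centralizer_singleton_iff] at hc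
    simp [hc]
  have hTimg : (fun t ↦ t * x * t⁻¹) '' (T : Set G) = (fun m ↦ x * m) '' (N : Set G) := by
    ext y
    constructor
    · rintro ⟨t, ht, rfl⟩
      exact ⟨_, (hT t).1 ht, by simp⟩
    · rintro ⟨m, hm, rfl⟩
      obtain ⟨g, hg⟩ := isConj_iff.1 (hx m hm)
      refine ⟨g, (hT g).2 ?_, hg⟩
      simpa [hg] using hm
  have cT := T.ncard_conj_image_mul_card x
  rw [inf_eq_right.2 hCT, hTimg, Set.ncard_image_of_injective _ (mul_right_injective x),
    ← Nat.card_coe_set_eq] at cT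
  have cS := (T ⊓ P).ncard_conj_image_mul_card x
  have hSN : N ⊔ (T ⊓ P) = T := by
    refine le_antisymm (sup_le hNT inf_le_left) fun t ht ↦ ?_
    obtain ⟨m, hm, s, hs, rfl⟩ := Subgroup.mem_sup_of_normal_left.1 (hNP ▸ Subgroup.mem_top t)
    exact Subgroup.mul_mem_sup hm ⟨(T.mul_mem_cancel_left (hNT hm)).1 ht, hs⟩
  have r1 : Nat.card N * N.relIndex T = Nat.card T := by
    simpa using Subgroup.relIndex_mul_relIndex ⊥ N T bot_le hNT
  have r2 : Nat.card (N ⊓ P : Subgroup G) * N.relIndex T = Nat.card (T ⊓ P : Subgroup G) := by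
    have := Subgroup.relIndex_mul_relIndex ⊥ (N ⊓ (T ⊓ P)) (T ⊓ P) bot_le inf_le_right
    rwa [Subgroup.inf_relIndex_right, Subgroup.relIndex_bot_left, Subgroup.relIndex_bot_left,
      ← inf_assoc, inf_eq_left.2 hNT, ← Subgroup.relIndex_sup_left, hSN] at this
  -- The index of `N ∩ P` in `T ∩ P` is that of `N` in `T`, namely `|C_G(x)|`.
  have r3 : N.relIndex T = Nat.card (Subgroup.centralizer {x}) :=
    Nat.eq_of_mul_eq_mul_left Nat.card_pos (r1.trans cT.symm)
  have hsub : (fun t ↦ t * x * t⁻¹) '' ((T ⊓ P : Subgroup G) : Set G) ⊆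
      (fun m ↦ x * m) '' ((N ⊓ P : Subgroup G) : Set G) := by
    rintro _ ⟨t, ht, rfl⟩
    exact ⟨_, ⟨(hT t).1 ht.1, P.mul_mem (P.inv_mem hxP)
      (P.mul_mem (P.mul_mem ht.2 hxP) (P.inv_mem ht.2))⟩, by simp⟩
  have hle : Nat.card (T ⊓ P ⊓ Subgroup.centralizer {x} : Subgroup G) ≤
      Nat.card (Subgroup.centralizer {x}) := Subgroup.card_le_of_le inf_le_right
  have heq := Set.eq_of_subset_of_ncard_le hsub (by
    rw [Set.ncard_image_of_injective _ (mul_right_injective x), ← Nat.card_coe_set_eq]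
    refine Nat.le_of_mul_le_mul_right (c := Nat.card (Subgroup.centralizer {x})) ?_ Nat.card_pos
    rw [← r3, SetLike.coe_sort_coe, r2, ← cS, r3]
    exact Nat.mul_le_mul_left _ hle) (Set.toFinite _)
  have : x * n ∈ (fun m ↦ x * m) '' ((N ⊓ P : Subgroup G) : Set G) := ⟨n, ⟨hnN, hnP⟩, rfl⟩
  rw [← heq] at this
  obtain ⟨s, hs, h⟩ := this
  exact ⟨s, hs.2, h⟩

/-! ### Transfer and normal complements -/

/-- The transfer of `f : H →* A` at an element `g`, all of whose conjugates lie in `H` and have the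
same value under `f`, is the `|G : H|`-th power of that value. -/
theorem MonoidHom.transfer_eq_pow_of_normal {G A : Type*} [Group G] [CommGroup A]
    {H : Subgroup G} [H.FiniteIndex] (f : H →* A) (g : G)
    (hg : ∀ t : G, t⁻¹ * g * t ∈ H)
    (hf : ∀ t : G, f ⟨t⁻¹ * g * t, hg t⟩ = f ⟨g, by simpa using hg 1⟩) :
    f.transfer g = f ⟨g, by simpa using hg 1⟩ ^ H.index := by
  classical
  let T : H.LeftTransversal := default
  let _ := H.fintypeQuotientOfFiniteIndex
  have hfix : ∀ q : G ⧸ H, g⁻¹ • q = q := by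
    intro q
    induction q using QuotientGroup.induction_on with
    | H t =>
      rw [MulAction.Quotient.smul_mk, QuotientGroup.eq]
      simpa [mul_assoc] using hg t
  rw [MonoidHom.transfer_def f T]
  unfold Subgroup.leftTransversals.diff
  rw [Subgroup.index_eq_card, Nat.card_eq_fintype_card, ← Finset.card_univ]
  refine Finset.prod_eq_pow_card fun q _ ↦ ?_
  rw [← hf (T.2.leftQuotientEquiv q)]
  congr 2
  rw [Subgroup.smul_apply_eq_smul_apply_inv_smul, hfix, smul_eq_mul, mul_assoc]

open Pointwise in
/-- The transfer step in the proof of Tate's theorem: when `G = KP` and `K` has no nontrivial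
`G`-invariant homomorphism to `A`, the `|G : P|`-th power of a `P`-invariant homomorphism
`f : K ∩ P →* A` extends to `P`. The extension is the restriction to the diagonal of the transfer
`Γ →* A` from `H`, where `Γ = G ×_{G/K} P`, the subgroup `H` is the preimage of `P` under the first
projection, and the homomorphism transferred is `(y, x) ↦ f (y⁻¹ x)` on `H`. -/
theorem exists_extend_pow_index {G A : Type*} [Group G] [Finite G] [CommGroup A]
    (K P : Subgroup G) [K.Normal] (hKP : K ⊔ P = ⊤)
    (hK : ∀ μ : K →* A, (∀ (g : G) (k : K), μ (MulAut.conjNormal g k) = μ k) → μ = 1)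
    (f : (K.subgroupOf P) →* A)
    (hf : ∀ (x : P) (q : K.subgroupOf P), f (MulAut.conjNormal x q) = f q) :
    ∃ F : P →* A, ∀ q : K.subgroupOf P, F q = f q ^ P.index := by
  let Γ : Subgroup (G × P) := MonoidHom.eqLocus
    ((QuotientGroup.mk' K).comp (MonoidHom.fst G P))
    ((QuotientGroup.mk' K).comp (P.subtype.comp (MonoidHom.snd G P)))
  have hΓ : ∀ g x, (g, x) ∈ Γ ↔ g⁻¹ * (x : G) ∈ K := fun g x ↦ QuotientGroup.eq
  let pr : Γ →* G := (MonoidHom.fst G P).comp Γ.subtype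
  have hpr : Function.Surjective pr := by
    intro g
    obtain ⟨m, hm, x, hx, rfl⟩ := Subgroup.mem_sup_of_normal_left.1 (hKP ▸ Subgroup.mem_top g)
    refine ⟨⟨(m * x, ⟨x, hx⟩), (hΓ _ _).2 ?_⟩, rfl⟩
    have := ‹K.Normal›.conj_mem m⁻¹ (K.inv_mem hm) x⁻¹
    simpa [mul_assoc] using this
  let H : Subgroup Γ := P.comap pr
  have hidx : H.index = P.index := Subgroup.index_comap_of_surjective P hpr
  have hmem : ∀ h : H, (⟨(h : Γ).1.1, h.2⟩⁻¹ * (h : Γ).1.2 : P) ∈ K.subgroupOf P := fun h ↦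
    (hΓ _ _).1 (h : Γ).2
  let π : H →* A :=
    { toFun := fun h ↦ f ⟨_, hmem h⟩
      map_one' := by
        rw [← map_one f]; congr 1; ext; simp
      map_mul' := fun a b ↦ by
        rw [mul_comm, ← hf ((b : Γ).1.2)⁻¹ ⟨_, hmem a⟩, ← map_mul]
        congr 1; ext
        simp [mul_assoc] }
  let θ : Γ →* A := π.transfer
  let ι : K →* Γ :=
    { toFun := fun k ↦ ⟨(k, 1), (hΓ _ _).2 (by simp)⟩
      map_one' := rfl
      map_mul' := fun a b ↦ by ext <;> simp }
  let δ : P →* Γ :=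
    { toFun := fun x ↦ ⟨(x, x), (hΓ _ _).2 (by simp)⟩
      map_one' := rfl
      map_mul' := fun a b ↦ rfl }
  -- `θ` restricts to a `G`-invariant homomorphism on `K × 1`.
  have hμ : θ.comp ι = 1 := by
    refine hK _ fun g k ↦ ?_
    obtain ⟨c, rfl⟩ := hpr g
    have : ι (MulAut.conjNormal (pr c) k) = c * ι k * c⁻¹ := by
      ext <;> simp [ι, pr, MulAut.conjNormal_apply]
    rw [MonoidHom.comp_apply, this, map_mul, map_mul, map_inv, mul_comm (θ c),
      mul_inv_cancel_right, MonoidHom.comp_apply]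
  refine ⟨θ.comp δ, fun q ↦ ?_⟩
  let e : Γ := ⟨(1, q), (hΓ _ _).2 (by simpa using Subgroup.mem_subgroupOf.1 q.2)⟩
  -- On `K ∩ P` the diagonal is the product of `K × 1`, where `θ` vanishes, and `1 × (K ∩ P)`.
  have h1 : δ q = ι ⟨q, q.2⟩ * e := by
    ext <;> simp [δ, ι, e]
  have he : ∀ t : Γ, t⁻¹ * e * t ∈ H := fun t ↦ by
    show (_ : G) ∈ P
    simp [pr, e]
  have h2 : θ e = π ⟨e, by simpa using he 1⟩ ^ H.index :=
    MonoidHom.transfer_eq_pow_of_normal π e he fun t ↦ by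
      show f _ = f _
      refine (congrArg f ?_).trans ((hf ((t : Γ).1.2)⁻¹ q).trans (congrArg f ?_)) <;>
      · ext
        simp [e]
  rw [MonoidHom.comp_apply, h1, map_mul, ← MonoidHom.comp_apply, hμ, h2, hidx]
  rw [MonoidHom.one_apply, one_mul]
  congr 1
  show f _ = f _
  congr 1; ext
  simp [e]

theorem Sylow.sup_eq_top_of_isPGroup_quotient {G : Type*} [Group G] [Finite G] {p : ℕ}
    [Fact p.Prime] (P : Sylow p G) {K : Subgroup G} [K.Normal] (hK : IsPGroup p (G ⧸ K)) :
    K ⊔ (P : Subgroup G) = ⊤ := by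
  obtain ⟨n, hn⟩ := IsPGroup.iff_card.1 hK
  have h1 : (K ⊔ (P : Subgroup G)).index ∣ p ^ n := by
    rw [← hn, ← Subgroup.index_eq_card]
    exact Subgroup.index_dvd_of_le le_sup_left
  have h2 := (Subgroup.index_dvd_of_le (le_sup_right : (P : Subgroup G) ≤ K ⊔ P))
  obtain ⟨k, -, hk⟩ := (Nat.dvd_prime_pow Fact.out).1 h1
  rcases k with _ | k
  · exact Subgroup.index_eq_one.1 (by simpa using hk)
  · exact absurd ((Dvd.intro_left (p ^ k) (by rw [hk, pow_succ])).trans h2) P.not_dvd_index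

theorem isPGroup_quotient_iff {G : Type*} [Group G] {p : ℕ} {K : Subgroup G} [K.Normal] :
    IsPGroup p (G ⧸ K) ↔ ∀ g : G, ∃ k, g ^ p ^ k ∈ K := by
  rw [isPGroup_iff_pow_pow_eq_one, QuotientGroup.mk_surjective.forall]
  simp_rw [← QuotientGroup.mk_pow, QuotientGroup.eq_one_iff]

open scoped IsMulCommutative in
/-- A case of Tate's theorem: if `P` is a Sylow `p`-subgroup and `K` is minimal among the normal
subgroups with `p`-group quotient, then `K ∩ P ≤ P'` forces `K ∩ P = 1`. Writing `Q = K ∩ P`, the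
homomorphism extended to `P` is the projection of `Q` to the central subgroup `Q/[Q, P]` of
`P/[Q, P]`; the extension kills `P'`, hence `Q`, so `Q = [Q, P]`. -/
theorem Subgroup.subgroupOf_eq_bot_of_le_commutator {G : Type*} [Group G] [Finite G] {p : ℕ}
    [Fact p.Prime] {P K : Subgroup G} [K.Normal]
    (hP : IsPGroup p P) (hcop : p.Coprime P.index) (hKP : K ⊔ P = ⊤) (hK : IsPGroup p (G ⧸ K))
    (hmin : ∀ L : Subgroup G, ∀ _ : L.Normal, L ≤ K → IsPGroup p (G ⧸ L) → K ≤ L)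
    (hcomm : K.subgroupOf P ≤ _root_.commutator P) : K.subgroupOf P = ⊥ := by
  have : Group.IsNilpotent P := hP.isNilpotent
  let R : Subgroup P := ⁅K.subgroupOf P, (⊤ : Subgroup P)⁆
  have hcen : ∀ q : K.subgroupOf P, ((q : P) : P ⧸ R) ∈ Subgroup.center (P ⧸ R) := by
    intro q
    rw [Subgroup.mem_center_iff]
    refine QuotientGroup.mk_surjective.forall.2 fun x ↦ ?_
    rw [← QuotientGroup.mk_mul, ← QuotientGroup.mk_mul, QuotientGroup.eq]
    have := Subgroup.commutator_mem_commutator (inv_mem q.2) (Subgroup.mem_top x⁻¹)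
    simpa [commutatorElement_def, mul_assoc] using this
  let f : K.subgroupOf P →* Subgroup.center (P ⧸ R) :=
    ((QuotientGroup.mk' R).comp (K.subgroupOf P).subtype).codRestrict _ hcen
  have hf : ∀ (x : P) (q : K.subgroupOf P), f (MulAut.conjNormal x q) = f q := by
    intro x q
    ext
    show ((x * q * x⁻¹ : P) : P ⧸ R) = _
    rw [QuotientGroup.mk_mul, QuotientGroup.mk_mul, Subgroup.mem_center_iff.1 (hcen q) x,
      ← QuotientGroup.mk_mul, ← QuotientGroup.mk_mul, mul_inv_cancel_right]
    rfl
  have hA : IsPGroup p (Subgroup.center (P ⧸ R)) := (hP.to_quotient R).to_subgroup _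
  have hinv : ∀ μ : K →* Subgroup.center (P ⧸ R),
      (∀ (g : G) (k : K), μ (MulAut.conjNormal g k) = μ k) → μ = 1 := by
    intro μ hμ
    have hL : (μ.ker.map K.subtype).Normal := by
      refine ⟨?_⟩
      rintro _ ⟨k, hk, rfl⟩ g
      exact ⟨MulAut.conjNormal g k, (hμ g k).trans hk, by simp⟩
    -- An invariant `μ` has kernel normal in `G` with `p`-group quotient, so minimality applies.
    have := hmin _ hL (Subgroup.map_subtype_le _) <| isPGroup_quotient_iff.2 fun g ↦ by
      obtain ⟨i, hi⟩ := isPGroup_quotient_iff.1 hK g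
      obtain ⟨j, hj⟩ := isPGroup_iff_pow_pow_eq_one.1 hA (μ ⟨_, hi⟩)
      refine ⟨i + j, ⟨⟨_, hi⟩ ^ p ^ j, ?_, ?_⟩⟩
      · exact (map_pow μ _ _).trans hj
      · simp [pow_add, pow_mul]
    ext1 k
    obtain ⟨k', hk', h⟩ := this k.2
    rwa [← Subtype.ext h]
  obtain ⟨F, hF⟩ := exists_extend_pow_index K P
    hKP hinv f hf
  refine Subgroup.eq_bot_of_le_commutator_top _ fun q hq ↦ ?_
  have h1 : f ⟨q, hq⟩ ^ P.index = 1 := by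
    rw [← hF]
    exact Abelianization.commutator_subset_ker F (hcomm hq)
  have h2 : f ⟨q, hq⟩ = 1 :=
    (hA.powEquiv hcop).injective (by simpa using h1)
  exact (QuotientGroup.eq_one_iff q).1 (congrArg Subtype.val h2)

theorem Sylow.exists_mem_inf_of_dvd_card {G : Type*} [Group G] [Finite G] {p : ℕ}
    [Fact p.Prime] (P : Sylow p G) {K : Subgroup G} [K.Normal] (hK : p ∣ Nat.card K) :
    ∃ x ∈ P, x ∈ K ∧ x ≠ 1 := by
  obtain ⟨x, hx⟩ := exists_prime_orderOf_dvd_card' p hK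
  have hz : IsPGroup p (Subgroup.zpowers (x : G)) :=
    IsPGroup.of_card (n := 1) (by rw [Nat.card_zpowers, Subgroup.orderOf_coe, hx, pow_one])
  obtain ⟨Q, hQ⟩ := hz.exists_le_sylow
  obtain ⟨g, hg⟩ := MulAction.exists_smul_eq G Q P
  refine ⟨g * x * g⁻¹, ?_, ‹K.Normal›.conj_mem _ x.2 g, ?_⟩
  · rw [← hg]
    exact Subgroup.smul_mem_pointwise_smul _ _ _ (hQ (Subgroup.mem_zpowers _))
  · rw [Ne, conj_eq_one_iff]
    intro h
    rw [← Subgroup.orderOf_coe, h, orderOf_one] at hx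
    exact (Fact.out : p.Prime).one_lt.ne hx

/-- Tate's theorem for a normal subgroup `N` with `p`-group quotient and `N ∩ P ≤ P'`: the group has
a normal `p`-complement. -/
theorem exists_normal_complement_of_le_commutator {G : Type*} [Group G] [Finite G] {p : ℕ}
    [Fact p.Prime] (P : Sylow p G) {N : Subgroup G} [N.Normal] (hN : IsPGroup p (G ⧸ N))
    (hcomm : N.subgroupOf P ≤ _root_.commutator P) :
    ∃ K : Subgroup G, ∃ _ : K.Normal, K ≤ N ∧ IsPGroup p (G ⧸ K) ∧ p.Coprime (Nat.card K) := by
  obtain ⟨K, ⟨hKn, hKN, hKp⟩, hmin⟩ := Set.Finite.exists_minimal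
    (s := {K : Subgroup G | ∃ _ : K.Normal, K ≤ N ∧ IsPGroup p (G ⧸ K)}) (Set.toFinite _)
    ⟨N, ‹_›, le_rfl, hN⟩
  refine ⟨K, hKn, hKN, hKp, (Nat.Prime.coprime_iff_not_dvd Fact.out).2 fun hdvd ↦ ?_⟩
  obtain ⟨x, hxP, hxK, hx⟩ := P.exists_mem_inf_of_dvd_card hdvd
  have := Subgroup.subgroupOf_eq_bot_of_le_commutator P.isPGroup'
    ((Nat.Prime.coprime_iff_not_dvd Fact.out).2 P.not_dvd_index)
    (P.sup_eq_top_of_isPGroup_quotient hKp) hKp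
    (fun L hL hLK hLp ↦ hmin ⟨hL, hLK.trans hKN, hLp⟩ hLK)
    ((Subgroup.comap_mono hKN).trans hcomm)
  have hx' : (⟨x, hxP⟩ : P) ∈ K.subgroupOf P := hxK
  rw [this, Subgroup.mem_bot] at hx'
  exact hx (congrArg Subtype.val hx')

/-! ### Fixed-point-free actions -/

/-- A finite commutative group `A` acting fixed-point-freely on a nontrivial abelian group `V` is
cyclic: for an associated prime `I` of the `ℤ[A]`-module `V`, fixed-point-freeness makes
`A → ℤ[A]/I` injective, and finite multiplicative subgroups of a domain are cyclic. -/
theorem isCyclic_of_fixedPointFree {A V : Type*} [CommGroup A] [Finite A] [AddCommGroup V]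
    [Nontrivial V] [DistribMulAction A V] (h : ∀ a : A, ∀ v : V, v ≠ 0 → a • v = v → a = 1) :
    IsCyclic A := by
  let ρ : Representation ℤ A V := 
    { toFun := fun a ↦ (DistribSMul.toAddMonoidHom V a).toIntLinearMap
      map_one' := by ext; simp
      map_mul' := fun a b ↦ by ext; simp [mul_smul] }
  have : Nontrivial ρ.asModule := ‹Nontrivial V›
  have : IsNoetherianRing (MonoidAlgebra ℤ A) := Algebra.FiniteType.isNoetherianRing ℤ _
  obtain ⟨I, hI⟩ := associatedPrimes.nonempty (MonoidAlgebra ℤ A) ρ.asModule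
  rw [AssociatedPrimes.mem_iff, isAssociatedPrime_iff] at hI
  obtain ⟨hI, v, rfl⟩ := hI
  refine isCyclic_of_injective_ringHom
    ((Ideal.Quotient.mk ((⊥ : Submodule _ ρ.asModule).colon {v})).toMonoidHom.comp
      (MonoidAlgebra.of ℤ A)) ?_
  rw [injective_iff_map_eq_one]
  intro a ha
  have hv : v ≠ 0 := by
    rintro rfl
    exact hI.ne_top (by simp)
  have := (Ideal.Quotient.eq (x := MonoidAlgebra.of ℤ A a) (y := 1)).1 ha
  rw [Submodule.mem_colon_singleton, Submodule.mem_bot, sub_smul, one_smul, sub_eq_zero] at this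
  have hav := congrArg ρ.asModuleEquiv this
  rw [Representation.asModuleEquiv_map_smul, MonoidAlgebra.of_apply,
    Representation.asAlgebraHom_single_one] at hav
  exact h a (ρ.asModuleEquiv v) (by simpa using hv) hav

open scoped IsMulCommutative in
/-- A group of automorphisms acting fixed-point-freely on a nontrivial finite abelian group has an
element that generates its own centralizer, namely a generator of a maximal commutative subgroup. -/
theorem exists_centralizer_inf_le_zpowers {V : Type*} [CommGroup V] [Nontrivial V] [Finite V]
    (H : Subgroup (MulAut V)) (h : ∀ a ∈ H, ∀ v : V, v ≠ 1 → a v = v → a = 1) :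
    ∃ a ∈ H, H ⊓ Subgroup.centralizer {a} ≤ Subgroup.zpowers a := by
  obtain ⟨A, ⟨hAH, hA⟩, hmax⟩ := Set.Finite.exists_maximal
    (s := {A : Subgroup (MulAut V) | A ≤ H ∧ IsMulCommutative A}) (Set.toFinite _)
    ⟨⊥, bot_le, inferInstance⟩
  have hcyc : IsCyclic A := by
    have : IsMulCommutative A := hA
    let act : DistribMulAction A (Additive V) :=
      { smul := fun a v ↦ .ofMul ((a : MulAut V) v.toMul)
        one_smul := fun v ↦ rfl
        mul_smul := fun a b v ↦ rfl
        smul_zero := fun a ↦ map_one (a : MulAut V)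
        smul_add := fun a v w ↦ map_mul (a : MulAut V) _ _ }
    exact isCyclic_of_fixedPointFree (A := A) (V := Additive V) fun a v hv hav ↦ by
      have hav' : (a : MulAut V) v.toMul = v.toMul := hav
      exact Subtype.ext (h a (hAH a.2) v.toMul hv hav')
  obtain ⟨⟨a, ha⟩, hgen⟩ := hcyc.exists_generator
  refine ⟨a, hAH ha, fun b hb ↦ ?_⟩
  have hAa : ∀ y ∈ A, y ∈ Subgroup.zpowers a := fun y hy ↦ by
    obtain ⟨i, hi⟩ := Subgroup.mem_zpowers_iff.1 (hgen ⟨y, hy⟩)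
    exact ⟨i, congrArg Subtype.val hi⟩
  have hba : b * a = a * b := Subgroup.mem_centralizer_singleton_iff.1 hb.2
  have hc : ∀ x ∈ ({a, b} : Set (MulAut V)), ∀ y ∈ ({a, b} : Set (MulAut V)), x * y = y * x := by
    rintro x (rfl | rfl) y (rfl | rfl) <;> first | rfl | exact hba | exact hba.symm
  have := hmax (y := Subgroup.closure {a, b}) ⟨by
    rw [Subgroup.closure_le]; rintro x (rfl | rfl); exacts [hAH ha, hb.1],
    Subgroup.isMulCommutative_closure hc⟩ fun y hy ↦ by
      refine (Subgroup.zpowers_le.2 (Subgroup.subset_closure ?_)) (hAa y hy)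
      simp
  exact hAa b (this (Subgroup.subset_closure (by simp)))

open Pointwise in
/-- A `p`-group normalizes some nontrivial abelian subgroup of any nontrivial normal `p'`-subgroup
`M`: it fixes a Sylow `q`-subgroup of `M`, for a prime `q` dividing `|M|`, and normalizes the center
of it. -/
theorem exists_commutative_le_normalizer {G : Type*} [Group G] [Finite G] {p : ℕ}
    [Fact p.Prime] {P M : Subgroup G} [M.Normal] (hP : IsPGroup p P) (hM : p.Coprime (Nat.card M))
    (hM1 : M ≠ ⊥) :
    ∃ V ≤ M, V ≠ ⊥ ∧ IsMulCommutative V ∧ P ≤ Subgroup.normalizer (V : Set G) := by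
  obtain ⟨q, hq, hqM⟩ := Nat.exists_prime_and_dvd (mt Subgroup.card_eq_one.1 hM1)
  have := Fact.mk hq
  let act : MulAction P (Sylow q M) :=
    MulAction.compHom (Sylow q M) ((MulAut.conjNormal (H := M)).comp P.subtype)
  have hnd : ¬ p ∣ Nat.card (Sylow q M) := fun h ↦
    (Nat.Prime.coprime_iff_not_dvd Fact.out).1 hM
      ((h.trans (default : Sylow q M).card_dvd_index).trans (Subgroup.index_dvd_card _))
  obtain ⟨Q, hQ⟩ := hP.nonempty_fixed_point_of_prime_not_dvd_card (Sylow q M) hnd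
  have hQ' : ∀ x ∈ P, ∀ w ∈ Q, MulAut.conjNormal x w ∈ Q := fun x hx w hw ↦ by
    have h : MulAut.conjNormal (H := M) x • Q = Q := hQ ⟨x, hx⟩
    rw [← h]
    exact Subgroup.smul_mem_pointwise_smul _ (MulAut.conjNormal (H := M) x) _ hw
  let W : Subgroup M := Q ⊓ Subgroup.centralizer (Q : Set M)
  have hW : ∀ x ∈ P, ∀ w ∈ W, MulAut.conjNormal x w ∈ W := fun x hx w hw ↦ by
    refine ⟨hQ' x hx w hw.1, Subgroup.mem_centralizer_iff.2 fun u hu ↦ ?_⟩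
    have h1 := Subgroup.mem_centralizer_iff.1 hw.2 _ (hQ' x⁻¹ (P.inv_mem hx) u hu)
    have h2 := congrArg (MulAut.conjNormal (H := M) x) h1
    have h3 : MulAut.conjNormal (H := M) x (MulAut.conjNormal x⁻¹ u) = u := by
      rw [← MulAut.mul_apply, ← map_mul, mul_inv_cancel, map_one, MulAut.one_apply]
    rwa [map_mul, map_mul, h3] at h2
  have hconj : ∀ x ∈ P, ∀ v ∈ W.map M.subtype, x * v * x⁻¹ ∈ W.map M.subtype := by
    rintro x hx _ ⟨w, hw, rfl⟩
    exact ⟨_, hW x hx w hw, by simp⟩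
  refine ⟨W.map M.subtype, Subgroup.map_subtype_le _, ?_, ?_, fun x hx ↦ ?_⟩
  · have : Nontrivial Q := (Subgroup.nontrivial_iff_ne_bot _).2 (Q.ne_bot_of_dvd_card hqM)
    have := Q.isPGroup'.center_nontrivial
    obtain ⟨⟨z, hz⟩, hz1⟩ := exists_ne (1 : Subgroup.center Q)
    intro hbot
    rw [Subgroup.map_eq_bot_iff_of_injective _ M.subtype_injective] at hbot
    have : (z : M) ∈ W := ⟨z.2, Subgroup.mem_centralizer_iff.2 fun u hu ↦
      congrArg Subtype.val (Subgroup.mem_center_iff.1 hz ⟨u, hu⟩)⟩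
    rw [hbot, Subgroup.mem_bot] at this
    exact hz1 (Subtype.ext (Subtype.ext this))
  · refine ⟨⟨?_⟩⟩
    rintro ⟨_, a, ha, rfl⟩ ⟨_, b, hb, rfl⟩
    exact Subtype.ext (congrArg M.subtype (Subgroup.mem_centralizer_iff.1 hb.2 a ha.1))
  · refine Subgroup.mem_normalizer_iff.2 fun v ↦ ⟨hconj x hx v, fun h ↦ ?_⟩
    simpa [mul_assoc] using hconj x⁻¹ (P.inv_mem hx) _ h

open scoped IsMulCommutative commutatorElement in
/-- Let `P` normalize the nontrivial abelian subgroup `V`, with `P ∩ N` acting trivially and the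
other elements of `P` without nontrivial fixed points. Some `x ∈ P \ N` then generates its own
centralizer modulo `C = P ∩ N`. If moreover all of `xC` is conjugate to `x` in `P`, the conjugating
elements may be taken in `C`, so `C = [x, C]`, which is impossible in a nilpotent group unless
`C = 1`. -/
theorem subgroupOf_eq_bot_of_fixedPointFree {G : Type*} [Group G] [Finite G]
    {P N V : Subgroup G} [N.Normal] [Group.IsNilpotent P] [IsMulCommutative V] (hV : V ≠ ⊥)
    (hPV : P ≤ Subgroup.normalizer (V : Set G)) (hPN : ¬ P ≤ N)
    (hfpf : ∀ x ∈ P, ∀ v ∈ V, v ≠ 1 → x * v = v * x → x ∈ N)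
    (hcen : ∀ x ∈ P, x ∈ N → ∀ v ∈ V, x * v = v * x)
    (hconj : ∀ x ∈ P, x ∉ N → ∀ n ∈ P, n ∈ N → ∃ s ∈ P, s * x * s⁻¹ = x * n) :
    N.subgroupOf P = ⊥ := by
  let ρ : P →* MulAut V := V.normalizerMonoidHom.comp (Subgroup.inclusion hPV)
  have hρ : ∀ (x : P) (v : V), ((ρ x v : V) : G) = x * v * (x : G)⁻¹ := fun x v ↦ rfl
  have hfix : ∀ (x : P) (v : V), ρ x v = v ↔ (x : G) * v = v * x := fun x v ↦ by
    rw [Subtype.ext_iff, hρ, mul_inv_eq_iff_eq_mul]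
  have hker : ∀ x : P, ρ x = 1 ↔ (x : G) ∈ N := by
    refine fun x ↦ ⟨fun h ↦ ?_, fun h ↦ ?_⟩
    · obtain ⟨v, hv⟩ := Subgroup.ne_bot_iff_exists_ne_one.1 hV
      exact hfpf x x.2 v v.2 (fun h ↦ hv (Subtype.ext h)) ((hfix x v).1 (by rw [h]; rfl))
    · ext1 v
      exact (hfix x v).2 (hcen x x.2 h v v.2)
  have : Nontrivial V := (Subgroup.nontrivial_iff_ne_bot _).2 hV
  obtain ⟨_, ⟨x, rfl⟩, hx⟩ := exists_centralizer_inf_le_zpowers ρ.range (by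
    rintro _ ⟨y, rfl⟩ v hv hyv
    exact (hker y).2 (hfpf y y.2 v v.2 (fun h ↦ hv (Subtype.ext h)) ((hfix y v).1 hyv)))
  have hxN : (x : G) ∉ N := by
    intro h
    rw [(hker x).2 h] at hx
    refine hPN fun y hy ↦ (hker ⟨y, hy⟩).1 ?_
    simpa using hx ⟨⟨⟨y, hy⟩, rfl⟩, by simp [Subgroup.mem_centralizer_singleton_iff]⟩
  refine Subgroup.eq_bot_of_le_commutator_top _ fun n hn ↦ ?_
  obtain ⟨s, hs, hsn⟩ := hconj x x.2 hxN n n.2 hn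
  lift s to P using hs
  have hsn' : s * x * s⁻¹ = x * n := Subtype.ext hsn
  have hρs : ρ s * ρ x = ρ x * ρ s := by
    have := congrArg ρ hsn'
    rwa [map_mul, map_mul, map_mul, map_inv, (hker n).2 hn, mul_one, mul_inv_eq_iff_eq_mul] at this
  obtain ⟨i, hi⟩ := Subgroup.mem_zpowers_iff.1
    (hx ⟨⟨s, rfl⟩, Subgroup.mem_centralizer_singleton_iff.2 hρs⟩)
  -- Dividing `s` by a power of `x` moves it into `P ∩ N` without changing `s x s⁻¹`.
  have hc : s * x ^ (-i) ∈ N.subgroupOf P := (hker (s * x ^ (-i))).1 (by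
    rw [map_mul, map_zpow, ← hi, zpow_neg, mul_inv_cancel])
  have hn' : n = ⁅x⁻¹, s * x ^ (-i)⁆ := by
    rw [← inv_mul_eq_iff_eq_mul.2 hsn', commutatorElement_def]
    group
  rw [hn', Subgroup.commutator_comm]
  exact Subgroup.commutator_mem_commutator (Subgroup.mem_top _) hc

/-! ### Camina pairs with a `p`-group quotient -/

/-- If `G/N` is a `p`-group and `x` is conjugate to all elements of `xN`, then `x` is a `p`-element:
some power of `x` is a `p`-element lying in `xN`. -/
theorem exists_pow_prime_pow_eq_one {G : Type*} [Group G] [Finite G] {p : ℕ}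
    [Fact p.Prime] {N : Subgroup G} [N.Normal] (hGN : IsPGroup p (G ⧸ N)) {x : G}
    (hx : ∀ n ∈ N, IsConj x (x * n)) : ∃ k, x ^ p ^ k = 1 := by
  obtain ⟨a, m, hm, ho⟩ := Nat.exists_eq_pow_mul_and_not_dvd (orderOf_pos x).ne' p
    (Fact.out : p.Prime).ne_one
  obtain ⟨b, hb⟩ := isPGroup_iff_pow_pow_eq_one.1 hGN (x : G ⧸ N)
  have hcop : (p ^ b).Coprime m :=
    Nat.Coprime.pow_left b ((Nat.Prime.coprime_iff_not_dvd Fact.out).2 hm)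
  obtain ⟨j, hj1, hj0⟩ := Nat.chineseRemainder hcop 1 0
  -- `x ^ j` is a `p`-element congruent to `x` modulo `N`.
  have hjN : x⁻¹ * x ^ j ∈ N := by
    rw [← QuotientGroup.eq, QuotientGroup.mk_pow]
    have := pow_eq_pow_iff_modEq.2 (hj1.of_dvd (orderOf_dvd_of_pow_eq_one hb))
    rw [this, pow_one]
  have hc := hx _ hjN
  rw [mul_inv_cancel_left] at hc
  obtain ⟨g, hg⟩ := isConj_iff.1 hc
  refine ⟨a, ?_⟩
  obtain ⟨c, rfl⟩ := (Nat.modEq_zero_iff_dvd).1 hj0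
  have h1 : (x ^ (m * c)) ^ p ^ a = 1 := by
    rw [← pow_mul, show m * c * p ^ a = orderOf x * c by rw [ho]; ring, pow_mul, pow_orderOf_eq_one,
      one_pow]
  rw [← hg, conj_pow, conj_eq_one_iff] at h1
  exact h1

/-- In a Camina pair with `G/N` a `p`-group, nontrivial `p'`-elements of `N` have their centralizers
inside `N`: for `x ∉ N` commuting with `m`, both `x` and `xm` are `p`-elements. -/
theorem IsCaminaPair.mem_of_commute {G : Type*} [Group G] [Finite G] {p : ℕ}
    [Fact p.Prime] {N : Subgroup G} [N.Normal] (hN : IsCaminaPair N) (hGN : IsPGroup p (G ⧸ N))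
    {m x : G} (hmN : m ∈ N) (hm : m ≠ 1) (hpm : p.Coprime (orderOf m)) (hxm : Commute x m) :
    x ∈ N := by
  by_contra hx
  obtain ⟨i, hi⟩ := exists_pow_prime_pow_eq_one hGN (hN.isConj x hx)
  obtain ⟨j, hj⟩ := exists_pow_prime_pow_eq_one hGN
    (hN.isConj (x * m) fun h ↦ hx ((N.mul_mem_cancel_right hmN).1 h))
  have h1 : m ^ p ^ (i + j) = 1 := by
    have h2 : (x * m) ^ p ^ (i + j) = 1 := by rw [add_comm, pow_add, pow_mul, hj, one_pow]
    rwa [hxm.mul_pow, pow_add, pow_mul x, hi, one_pow, one_mul, ← pow_add] at h2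
  exact hm (orderOf_eq_one_iff.1 ((hpm.symm.pow_right _).eq_one_of_dvd
    (orderOf_dvd_of_pow_eq_one h1)))

theorem IsCaminaPair.eq_of_isPGroup_quotient {G : Type*} [Group G] {N : Subgroup G} [N.Normal]
    (hN : IsCaminaPair N) {p q : ℕ} (hp : p.Prime) (hq : q.Prime) (hGp : IsPGroup p (G ⧸ N))
    (hGq : IsPGroup q (G ⧸ N)) : p = q := by
  by_contra hne
  refine hN.ne_top (eq_top_iff.2 fun x _ ↦ ?_)
  obtain ⟨i, hi⟩ := isPGroup_iff_pow_pow_eq_one.1 hGp (x : G ⧸ N)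
  obtain ⟨j, hj⟩ := isPGroup_iff_pow_pow_eq_one.1 hGq (x : G ⧸ N)
  rw [← QuotientGroup.eq_one_iff, ← orderOf_eq_one_iff]
  exact Nat.eq_one_of_dvd_coprimes (Nat.Coprime.pow i j ((Nat.coprime_primes hp hq).2 hne))
    (orderOf_dvd_of_pow_eq_one hi) (orderOf_dvd_of_pow_eq_one hj)

open scoped commutatorElement in
/-- `P ∩ N ≤ P'` for every supplement `P` of `N`: if `x ∈ P \ N`, each `n ∈ P ∩ N` is a commutator
`[x⁻¹, s]` with `s ∈ P`. -/
theorem IsCaminaPair.subgroupOf_le_commutator {G : Type*} [Group G] [Finite G] {N P : Subgroup G}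
    [N.Normal] (hN : IsCaminaPair N) (hNP : N ⊔ P = ⊤) :
    N.subgroupOf P ≤ _root_.commutator P := by
  have hPN : ¬ P ≤ N := fun h ↦ hN.ne_top (by rwa [sup_eq_left.2 h] at hNP)
  obtain ⟨x, hxP, hxN⟩ := Set.not_subset.1 hPN
  intro n hn
  obtain ⟨s, hs, hsn⟩ := exists_mem_conj_eq_mul hNP hxP (hN.isConj x hxN) n.2 hn
  have hn' : n = ⁅(⟨x, hxP⟩ : P)⁻¹, ⟨s, hs⟩⁆ := by
    refine Subtype.ext ?_
    rw [← inv_mul_eq_iff_eq_mul.2 hsn]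
    simp [commutatorElement_def, mul_assoc]
  rw [hn']
  exact Subgroup.commutator_mem_commutator (Subgroup.mem_top _) (Subgroup.mem_top _)

/-- Equality would let `P/(P ∩ N)` act fixed-point-freely on an abelian subgroup of `M`, so that
`subgroupOf_eq_bot_of_fixedPointFree` gives `P ∩ N = 1`. -/
theorem IsCaminaPair.inf_centralizer_lt {G : Type*} [Group G] [Finite G] {p : ℕ} [Fact p.Prime]
    {N M : Subgroup G} [N.Normal] [M.Normal] (hN : IsCaminaPair N) (hGN : IsPGroup p (G ⧸ N))
    (hpN : p ∣ Nat.card N) (P : Sylow p G) (hMN : M ≤ N) (hM : M ≠ ⊥)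
    (hpM : p.Coprime (Nat.card M)) :
    (P : Subgroup G) ⊓ Subgroup.centralizer (M : Set G) < (P : Subgroup G) ⊓ N := by
  have hfpf : ∀ v ∈ M, v ≠ 1 → ∀ x : G, x * v = v * x → x ∈ N := fun v hv hv1 x hxv ↦
    hN.mem_of_commute hGN (hMN hv) hv1
      (hpM.coprime_dvd_right (Subgroup.orderOf_dvd_natCard M hv)) hxv
  have hNP := P.sup_eq_top_of_isPGroup_quotient hGN
  refine lt_of_le_of_ne (le_inf inf_le_left fun x hx ↦ ?_) fun heq ↦ ?_
  · obtain ⟨v, hv⟩ := Subgroup.ne_bot_iff_exists_ne_one.1 hM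
    exact hfpf v v.2 (fun h ↦ hv (Subtype.ext h)) x
      (Subgroup.mem_centralizer_iff.1 hx.2 v v.2).symm
  · obtain ⟨V, hVM, hV, hVc, hPV⟩ := exists_commutative_le_normalizer P.isPGroup' hpM hM
    have : Group.IsNilpotent (P : Subgroup G) := P.isPGroup'.isNilpotent
    have hbot : N.subgroupOf (P : Subgroup G) = ⊥ := subgroupOf_eq_bot_of_fixedPointFree hV hPV
      (fun h ↦ hN.ne_top (by rwa [sup_eq_left.2 h] at hNP))
      (fun x _ v hv hv1 hxv ↦ hfpf v (hVM hv) hv1 x hxv)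
      (fun x hxP hxN v hv ↦ by
        have hx : x ∈ (P : Subgroup G) ⊓ Subgroup.centralizer (M : Set G) := heq ▸ ⟨hxP, hxN⟩
        exact (Subgroup.mem_centralizer_iff.1 hx.2 v (hVM hv)).symm)
      (fun x hxP hxN n hnP hnN ↦ exists_mem_conj_eq_mul hNP hxP (hN.isConj x hxN) hnP hnN)
    obtain ⟨x, hxP, hxN, hx⟩ := P.exists_mem_inf_of_dvd_card hpN
    have hx' : (⟨x, hxP⟩ : (P : Subgroup G)) ∈ N.subgroupOf (P : Subgroup G) := hxN
    rw [hbot, Subgroup.mem_bot] at hx'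
    exact hx (congrArg Subtype.val hx')

/-! ### The cores `O_p(G)` and `O_{p'}(G)` -/

theorem pPrimeCore_eq_of_isPGroup_quotient {G : Type*} [Group G] [Finite G] {p : ℕ}
    {K : Subgroup G} [hKn : K.Normal] (hK : IsPGroup p (G ⧸ K)) (hpK : p.Coprime (Nat.card K)) :
    pPrimeCore p G = K := by
  refine le_antisymm (sSup_le ?_) (le_sSup ⟨hKn, hpK⟩)
  rintro H ⟨-, hH⟩ h hh
  obtain ⟨k, hk⟩ := isPGroup_iff_pow_pow_eq_one.1 hK (h : G ⧸ K)
  rw [← QuotientGroup.eq_one_iff, ← orderOf_eq_one_iff]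
  refine Nat.eq_one_of_dvd_coprimes (Nat.Coprime.pow_left k hH) (orderOf_dvd_of_pow_eq_one hk) ?_
  exact (orderOf_map_dvd (QuotientGroup.mk' K) h).trans (Subgroup.orderOf_dvd_natCard H hh)

/-- With `M` a normal `p`-complement, `C_P(M)` is normalized by both `P` and `M`. -/
theorem pCore_eq_inf_centralizer {G : Type*} [Group G] [Finite G] {p : ℕ} [Fact p.Prime]
    (P : Sylow p G) {M : Subgroup G} [hMn : M.Normal] (hM : IsPGroup p (G ⧸ M))
    (hpM : p.Coprime (Nat.card M)) :
    pCore p G = (P : Subgroup G) ⊓ Subgroup.centralizer (M : Set G) := by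
  refine le_antisymm (sSup_le ?_) (le_sSup ⟨?_, P.isPGroup'.to_inf_left⟩)
  · rintro H ⟨hHn, hH⟩
    refine le_inf (hH.le_sylow_of_normal P) fun h hh ↦ Subgroup.mem_centralizer_iff.2 fun m hm ↦ ?_
    have hdis : Disjoint M H := by
      obtain ⟨n, hn⟩ := IsPGroup.iff_card.1 hH
      refine Subgroup.disjoint_of_coprime_natCard ?_
      rw [hn]
      exact (hpM.pow_left n).symm
    exact Subgroup.commute_of_normal_of_disjoint M H hMn hHn hdis m h hm hh
  · rw [← Subgroup.normalizer_eq_top_iff, eq_top_iff, ← P.sup_eq_top_of_isPGroup_quotient hM]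
    have hn : (P : Subgroup G) ≤ Subgroup.normalizer ((P : Subgroup G) : Set G) :=
      Subgroup.le_normalizer
    refine sup_le (fun m hm ↦ Subgroup.mem_normalizer_iff.2 fun c ↦ ?_)
      fun x hx ↦ Subgroup.mem_normalizer_iff.2 fun c ↦ ?_
    · have hfix : ∀ d ∈ (P : Subgroup G) ⊓ Subgroup.centralizer (M : Set G), m * d * m⁻¹ = d :=
        fun d hd ↦ mul_inv_eq_iff_eq_mul.2 (Subgroup.mem_centralizer_iff.1 hd.2 m hm)
      refine ⟨fun h ↦ by rwa [hfix c h], fun h ↦ ?_⟩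
      rwa [mul_left_cancel (mul_right_cancel (hfix _ h))] at h
    · rw [Subgroup.mem_inf, Subgroup.mem_inf]
      have h1 := Subgroup.mem_normalizer_iff.1 (hn hx) c
      have h2 := (inferInstance : (Subgroup.centralizer (M : Set G)).Normal)
      exact and_congr h1 ⟨fun h ↦ h2.conj_mem c h x, fun h ↦ by
        simpa [mul_assoc] using h2.conj_mem _ h x⁻¹⟩

theorem inf_centralizer_eq_iInf {G : Type*} [Group G] (P M : Subgroup G) :
    P ⊓ Subgroup.centralizer (M : Set G) = ⨅ v ∈ M, P ⊓ Subgroup.centralizer {v} := by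
  ext x
  simp only [Subgroup.mem_iInf, Subgroup.mem_inf, Subgroup.mem_centralizer_iff,
    Set.mem_singleton_iff, forall_eq, SetLike.mem_coe]
  exact ⟨fun h v hv ↦ ⟨h.1, h.2 v hv⟩, fun h ↦ ⟨(h 1 M.one_mem).1, fun v hv ↦ (h v hv).2⟩⟩

theorem lemma3p3 {G : Type*} [Group G] [Finite G] (N : Subgroup G) [N.Normal]
    (hN : IsCaminaPairType4 N) (p : ℕ) (hp : p.Prime) (hGN : IsPGroup p (G ⧸ N))
    (P : Sylow p G) :
    pCore p G = (P : Subgroup G) ⊓ Subgroup.centralizer (pPrimeCore p G : Set G) ∧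
    (P : Subgroup G) ⊓ Subgroup.centralizer (pPrimeCore p G : Set G) =
      (⨅ v ∈ pPrimeCore p G, (P : Subgroup G) ⊓ Subgroup.centralizer {v}) ∧
    (⨅ v ∈ pPrimeCore p G, (P : Subgroup G) ⊓ Subgroup.centralizer {v}) <
      (P : Subgroup G) ⊓ N := by
  have := Fact.mk hp
  obtain ⟨hC, q, hq, hGq, hqN, hNq⟩ := hN
  obtain rfl := hC.eq_of_isPGroup_quotient hp hq hGN hGq
  obtain ⟨K, hKn, hKN, hKp, hpK⟩ := exists_normal_complement_of_le_commutator P hGN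
    (hC.subgroupOf_le_commutator (P.sup_eq_top_of_isPGroup_quotient hGN))
  have hK : K ≠ ⊥ := by
    rintro rfl
    refine hNq (IsPGroup.to_subgroup (isPGroup_iff_pow_pow_eq_one.2 fun g ↦ ?_) N)
    simpa using isPGroup_quotient_iff.1 hKp g
  rw [← inf_centralizer_eq_iInf, pPrimeCore_eq_of_isPGroup_quotient hKp hpK]
  exact ⟨pCore_eq_inf_centralizer P hKp hpK, rfl, hC.inf_centralizer_lt hGN hqN P hKN hK hpK⟩
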